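/- Let $(R,\mathfrak m)$ be a Noetherian local ring and let $I_1, I_2$ be ideals of $R$ such that $I_1$ contains a reduction of $I_2$, i.e. there is an ideal $J\subseteq I_1\cap I_2$ with $I_2^{n+1}=JI_2^{n}$ for some $n\ge 0$ (this is automatic if $I_2\subseteq I_1$). Put $$G(I_2)=\bigoplus_{n\ge 0} I_2^n/I_2^{n+1},\qquad F_{I_1}(I_2)=\bigoplus_{n\ge 0} I_2^n/I_1I_2^{n},\qquad G_{I_1}(I_2)=R/I_1\oplus\bigoplus_{n\ge 1} I_1I_2^{n-1}/I_1I_2^{n}.$$ The first two are graded rings, and their depth is the depth with respect to the image of the homogeneous maximal ideal $\mathfrak m\oplus\bigoplus_{n\ge1}I_2^nt^n$ of the Rees algebra $R[I_2t]$. The third is a graded module over the Rees algebra $R[(I_1\cap I_2)t]$ (which is $R[I_2t]$ if $I_2\subseteq I_1$), and its depth is the depth with respect to the homogeneous maximal ideal $\mathfrak m\oplus\bigoplus_{n\ge 1}(I_1\cap I_2)^nt^n$ of that algebra. (The zero module has depth $\infty$.) If $$\operatorname{depth} G(I_2)<\operatorname{depth} G_{I_1}(I_2),$$ then $$\operatorname{depth}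 F_{I_1}(I_2)=\operatorname{depth} G(I_2)+1 .$$ -/

import Mathlib

open Polynomial

/-- The depth (grade) of an `A`-module `M` with respect to an ideal `𝔞`: the supremum of the
lengths of the `M`-regular sequences contained in `𝔞`. For a finite module `M` over a Noetherian
ring with `𝔞 M ≠ M`, the sequences below automatically satisfy `M ≠ (rs) M`; if `𝔞 M = M`
(for example `M = 0`) the value is `⊤`, which is the usual convention. -/
noncomputable def depthWrt {A : Type*} [CommRing A] (𝔞 : Ideal A)
    (M : Type*) [AddCommGroup M] [Module A M] : ℕ∞ :=
  ⨆ (rs : List A) (_ : (∀ r ∈ rs, r ∈ 𝔞) ∧ RingTheory.Sequence.IsWeaklyRegular M rs),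
    (rs.length : ℕ∞)

/-- `J` is a reduction of `I`: `J ⊆ I` and `I ^ (n + 1) = J I ^ n` for some `n`. -/
def IsReductionOf {R : Type*} [CommRing R] (J I : Ideal R) : Prop :=
  J ≤ I ∧ ∃ n : ℕ, I ^ (n + 1) = J * I ^ n

/-- The quotient module `N / (N' ∩ N)` of two submodules `N`, `N'` of a module. -/
abbrev Subquotient {A M : Type*} [CommRing A] [AddCommGroup M] [Module A M]
    (N N' : Submodule A M) : Type _ := N ⧸ N'.submoduleOf N

section

variable {R : Type*} [CommRing R]

/-- The homogeneous maximal ideal `𝔪 ⊕ I t ⊕ I² t² ⊕ ⋯` of the Rees algebra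
`R[It] = ⨁ Iⁿ tⁿ ⊆ R[t]` of an ideal `I` of a local ring `(R, 𝔪)`. -/
def reesMaximalIdeal [IsLocalRing R] (I : Ideal R) : Ideal (reesAlgebra I) where
  carrier := { f | (f : R[X]).coeff 0 ∈ IsLocalRing.maximalIdeal R }
  add_mem' {f g} hf hg := by
    simpa using Ideal.add_mem (IsLocalRing.maximalIdeal R) hf hg
  zero_mem' := by simp
  smul_mem' c f hf := by
    simpa [mul_coeff_zero] using
      Ideal.mul_mem_left (IsLocalRing.maximalIdeal R) ((c : R[X]).coeff 0) hf

/-- The homogeneous ideal `⨁ I₁ I₂ⁿ tⁿ` of the Rees algebra `R[I₂t] = ⨁ I₂ⁿ tⁿ`. -/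
def fiberIdeal (I₁ I₂ : Ideal R) : Ideal (reesAlgebra I₂) where
  carrier := { f | ∀ n, (f : R[X]).coeff n ∈ I₁ * I₂ ^ n }
  add_mem' {f g} hf hg n := by
    simpa using Ideal.add_mem _ (hf n) (hg n)
  zero_mem' n := by simp
  smul_mem' c f hf n := by
    rw [smul_eq_mul, MulMemClass.coe_mul, coeff_mul]
    refine Ideal.sum_mem _ fun x hx => ?_
    have h := Ideal.mul_mem_mul (c.2 x.1) (hf x.2)
    rwa [mul_left_comm, ← pow_add, Finset.HasAntidiagonal.mem_antidiagonal.mp hx] at h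

/-- The fiber cone `F_{I₁}(I₂) = ⨁_{n ≥ 0} I₂ⁿ / I₁ I₂ⁿ` of `I₂` with respect to `I₁`, as a ring. -/
abbrev FiberCone (I₁ I₂ : Ideal R) : Type _ := reesAlgebra I₂ ⧸ fiberIdeal I₁ I₂

/-- The associated graded ring `G(I) = ⨁_{n ≥ 0} Iⁿ / Iⁿ⁺¹ = F_I(I)`. -/
abbrev AssocGradedRing (I : Ideal R) : Type _ := FiberCone I I

/-- The depth of the graded ring `F_{I₁}(I₂)`, that is, its depth with respect to the image of
the homogeneous maximal ideal of the Rees algebra (the homogeneous maximal ideal of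
`F_{I₁}(I₂)` if `I₁` is proper). -/
noncomputable def depthFiberCone [IsLocalRing R] (I₁ I₂ : Ideal R) : ℕ∞ :=
  depthWrt ((reesMaximalIdeal I₂).map (Ideal.Quotient.mk (fiberIdeal I₁ I₂))) (FiberCone I₁ I₂)

/-- The depth of the associated graded ring `G(I)` with respect to its homogeneous maximal
ideal. -/
noncomputable def depthAssocGradedRing [IsLocalRing R] (I : Ideal R) : ℕ∞ :=
  depthWrt ((reesMaximalIdeal I).map (Ideal.Quotient.mk (fiberIdeal I I))) (AssocGradedRing I)

/-- The `n`-th term of the filtration `R ⊇ I₁ ⊇ I₁ I₂ ⊇ I₁ I₂² ⊇ ⋯`. -/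
def mixedFiltration (I₁ I₂ : Ideal R) : ℕ → Ideal R
  | 0 => ⊤
  | n + 1 => I₁ * I₂ ^ n

/-- For `x ∈ (I₁ ∩ I₂) ^ i`, multiplication by `x` raises the filtration degree by `i`. -/
theorem mul_mem_mixedFiltration {I₁ I₂ : Ideal R} {i j : ℕ} {x y : R}
    (hx : x ∈ (I₁ ⊓ I₂) ^ i) (hy : y ∈ mixedFiltration I₁ I₂ j) :
    x * y ∈ mixedFiltration I₁ I₂ (i + j) := by
  cases j with
  | zero =>
    cases i with
    | zero => trivial
    | succ i =>
      refine Ideal.mul_mem_right _ _ ?_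
      rw [pow_succ'] at hx
      exact Ideal.mul_mono inf_le_left (Ideal.pow_right_mono inf_le_right i) hx
  | succ j =>
    have h := Ideal.mul_mem_mul (Ideal.pow_right_mono (inf_le_right : I₁ ⊓ I₂ ≤ I₂) i hx) hy
    rw [mixedFiltration, mul_left_comm, ← pow_add] at h
    exact h

/-- `⨁_{n ≥ 0} M_n tⁿ`, where `M_0 = R` and `M_n = I₁ I₂ⁿ⁻¹` for `n ≥ 1`, as a graded module over
the Rees algebra of `I₁ ∩ I₂` (which is the Rees algebra of `I₂` if `I₂ ⊆ I₁`). -/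
def mixedReesModule (I₁ I₂ : Ideal R) : Submodule (reesAlgebra (I₁ ⊓ I₂)) R[X] where
  carrier := { f | ∀ n, f.coeff n ∈ mixedFiltration I₁ I₂ n }
  add_mem' {f g} hf hg n := by
    simpa using Ideal.add_mem _ (hf n) (hg n)
  zero_mem' n := by simp
  smul_mem' c f hf n := by
    rw [Subalgebra.smul_def, smul_eq_mul, coeff_mul]
    refine Ideal.sum_mem _ fun x hx => ?_
    have h := mul_mem_mixedFiltration (c.2 x.1) (hf x.2)
    rwa [Finset.HasAntidiagonal.mem_antidiagonal.mp hx] at h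

/-- `⨁_{n ≥ 0} M_{n+1} tⁿ`, where `M_{n+1} = I₁ I₂ⁿ`. -/
def mixedReesModuleShift (I₁ I₂ : Ideal R) : Submodule (reesAlgebra (I₁ ⊓ I₂)) R[X] where
  carrier := { f | ∀ n, f.coeff n ∈ mixedFiltration I₁ I₂ (n + 1) }
  add_mem' {f g} hf hg n := by
    simpa using Ideal.add_mem _ (hf n) (hg n)
  zero_mem' n := by simp
  smul_mem' c f hf n := by
    rw [Subalgebra.smul_def, smul_eq_mul, coeff_mul]
    refine Ideal.sum_mem _ fun x hx => ?_
    have h := mul_mem_mixedFiltration (c.2 x.1) (hf x.2)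
    rwa [← add_assoc, Finset.HasAntidiagonal.mem_antidiagonal.mp hx] at h

/-- `G_{I₁}(I₂) = R/I₁ ⊕ ⨁_{n ≥ 1} I₁ I₂ⁿ⁻¹ / I₁ I₂ⁿ`, the graded module of the filtration
`R ⊇ I₁ ⊇ I₁ I₂ ⊇ I₁ I₂² ⊇ ⋯`, over the Rees algebra of `I₁ ∩ I₂`. -/
abbrev MixedAssocGraded (I₁ I₂ : Ideal R) : Type _ :=
  Subquotient (mixedReesModule I₁ I₂) (mixedReesModuleShift I₁ I₂)

/-- The depth of the graded module `G_{I₁}(I₂)` with respect to the homogeneous maximal ideal of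
the Rees algebra acting on it. -/
noncomputable def depthMixedAssocGraded [IsLocalRing R] (I₁ I₂ : Ideal R) : ℕ∞ :=
  depthWrt (reesMaximalIdeal (I₁ ⊓ I₂)) (MixedAssocGraded I₁ I₂)

end

/-! Let E be the quotient of R ⊕ ⨁_{n ≥ 1} I₂ⁿ⁻¹ tⁿ by ⨁ I₁ I₂ⁿ tⁿ (`MixedQuotient`). Up to degree
shifts it is an extension in two ways: 0 → G_{I₁}(I₂) → E → F_{I₁}(I₂) → 0 and 0 → F_{I₁}(I₂) → E →
G(I₂) → 0, where both maps out of E divide by t. The composite F → E → F lowers the degree by one,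
and it is nilpotent since the reduction forces I₂ᴺ⁺¹ ⊆ I₁ I₂ᴺ for some N.

The rest is homological (`hasRegularSequence_of_isNilpotent`). Write M = G_{I₁}(I₂), F = F_{I₁}(I₂),
G = G(I₂), and let n = depth G < depth M. In local cohomology both maps Hⁱ(F) → Hⁱ(E) → Hⁱ(F) are
injective for i ≤ n; their composite is nilpotent, so Hⁱ(F) = 0 and then Hⁿ(E) = 0. Hence 0 ≠ Hⁿ(G)
embeds in Hⁿ⁺¹(F), and depth F = n + 1. The proof replaces cohomology by an induction: dividing by
an element regular on M, F and G lowers n to 0, where only socles matter.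

All modules live over R[(I₁ ∩ I₂)t]. Since R[I₂t] is finite over it and the homogeneous maximal
ideals agree up to radical, the depths of the cones do not change
(`hasRegularSequence_fiberCone_iff`). -/

open RingTheory.Sequence

/-! ### Regular sequences, socles and depth -/

section Depth

universe u

variable {A : Type*} [CommRing A] (𝔞 : Ideal A)

/-- There is a weakly `M`-regular sequence of length `n` in the ideal `𝔞`. -/
def HasRegularSequence (n : ℕ) (M : Type*) [AddCommGroup M] [Module A M] : Prop :=
  ∃ rs : List A, rs.length = n ∧ (∀ r ∈ rs, r ∈ 𝔞) ∧ IsWeaklyRegular M rs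

/-- No nonzero element of `M` is annihilated by `𝔞`. -/
def HasTrivialSocle (M : Type*) [AddCommGroup M] [Module A M] : Prop :=
  ∀ m : M, (∀ a ∈ 𝔞, a • m = 0) → m = 0

variable {𝔞}

theorem hasRegularSequence_zero (M : Type*) [AddCommGroup M] [Module A M] :
    HasRegularSequence 𝔞 0 M :=
  ⟨[], rfl, by simp, .nil A M⟩

theorem hasRegularSequence_succ_iff {n : ℕ} {M : Type*} [AddCommGroup M] [Module A M] :
    HasRegularSequence 𝔞 (n + 1) M ↔
      ∃ x ∈ 𝔞, IsSMulRegular M x ∧ HasRegularSequence 𝔞 n (QuotSMulTop x M) := by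
  constructor
  · rintro ⟨rs, hl, hmem, hreg⟩
    obtain ⟨x, rs, rfl⟩ := List.exists_cons_of_length_eq_add_one hl
    rw [isWeaklyRegular_cons_iff] at hreg
    exact ⟨x, hmem x (by simp), hreg.1, rs, by simpa using hl,
      fun r hr => hmem r (by simp [hr]), hreg.2⟩
  · rintro ⟨x, hx, hreg, rs, hl, hmem, hrs⟩
    refine ⟨x :: rs, by simp [hl], ?_, .cons hreg hrs⟩
    simpa [hx] using hmem

theorem HasRegularSequence.mono {m n : ℕ} (hmn : m ≤ n) {M : Type*} [AddCommGroup M] [Module A M]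
    (h : HasRegularSequence 𝔞 n M) : HasRegularSequence 𝔞 m M := by
  obtain ⟨rs, hl, hmem, hreg⟩ := h
  rw [← List.take_append_drop m rs, isWeaklyRegular_append_iff] at hreg
  exact ⟨rs.take m, by simp [hl, hmn], fun r hr => hmem r (List.mem_of_mem_take hr), hreg.1⟩

theorem coe_le_depthWrt_iff {n : ℕ} {M : Type*} [AddCommGroup M] [Module A M] :
    (n : ℕ∞) ≤ depthWrt 𝔞 M ↔ HasRegularSequence 𝔞 n M := by
  constructor
  · intro h
    by_contra hn
    obtain _ | n := n
    · exact hn (hasRegularSequence_zero M)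
    have hle : depthWrt 𝔞 M ≤ n := by
      refine iSup₂_le fun rs hrs => ?_
      rw [Nat.cast_le, ← Nat.lt_succ_iff]
      by_contra! hlt
      exact hn (HasRegularSequence.mono hlt ⟨rs, rfl, hrs.1, hrs.2⟩)
    have := h.trans hle
    rw [Nat.cast_le] at this
    omega
  · rintro ⟨rs, hl, h⟩
    exact le_iSup₂_of_le rs h (by rw [hl])

theorem depthWrt_eq_coe_iff {n : ℕ} {M : Type*} [AddCommGroup M] [Module A M] :
    depthWrt 𝔞 M = n ↔ HasRegularSequence 𝔞 n M ∧ ¬ HasRegularSequence 𝔞 (n + 1) M := by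
  rw [← coe_le_depthWrt_iff, ← coe_le_depthWrt_iff, not_le, Nat.cast_succ,
    ENat.lt_natCast_add_one_iff, le_antisymm_iff, and_comm]

theorem HasRegularSequence.congr {n : ℕ} {M N : Type*} [AddCommGroup M] [Module A M]
    [AddCommGroup N] [Module A N] (e : M ≃ₗ[A] N) (h : HasRegularSequence 𝔞 n M) :
    HasRegularSequence 𝔞 n N := by
  obtain ⟨rs, hl, hmem, hreg⟩ := h
  exact ⟨rs, hl, hmem, (e.isWeaklyRegular_congr rs).mp hreg⟩

/-- Dividing out `s` and then `r` is the same as dividing out `r` and then `s`. -/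
noncomputable def quotSMulTopComm (r s : A) (M : Type*) [AddCommGroup M] [Module A M] :
    QuotSMulTop r (QuotSMulTop s M) ≃ₗ[A] QuotSMulTop s (QuotSMulTop r M) :=
  QuotSMulTop.congr r (QuotSMulTop.equivTensorQuot s M) ≪≫ₗ
    (QuotSMulTop.quotSMulTopTensorEquivQuotSMulTop r _ _).symm ≪≫ₗ
    (QuotSMulTop.equivTensorQuot s _).symm

theorem QuotSMulTop.mk_eq_zero_iff {x : A} {M : Type*} [AddCommGroup M] [Module A M] {m : M} :
    (Submodule.Quotient.mk m : QuotSMulTop x M) = 0 ↔ ∃ m', x • m' = m := by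
  rw [Submodule.Quotient.mk_eq_zero, Submodule.mem_smul_pointwise_iff_exists]
  simp

theorem IsSMulRegular.eq_of_smul_quotSMulTop {x z : A} {M : Type*} [AddCommGroup M] [Module A M]
    (h : IsSMulRegular (QuotSMulTop x M) z) {m m' : M} (hm : z • m = x • m') :
    ∃ m'', x • m'' = m := by
  rw [← QuotSMulTop.mk_eq_zero_iff]
  apply h.right_eq_zero_of_smul
  rw [← Submodule.Quotient.mk_smul, QuotSMulTop.mk_eq_zero_iff]
  exact ⟨m', hm.symm⟩

/-- This is the half of permutability of regular sequences that needs neither a local ring nor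
finiteness. -/
theorem IsSMulRegular.quotSMulTop_swap {x z : A} {M : Type*} [AddCommGroup M] [Module A M]
    (hx : IsSMulRegular M x) (hz : IsSMulRegular (QuotSMulTop x M) z) :
    IsSMulRegular (QuotSMulTop z M) x := by
  rw [isSMulRegular_iff_right_eq_zero_of_smul]
  intro m hm
  obtain ⟨m, rfl⟩ := Submodule.Quotient.mk_surjective _ m
  rw [← Submodule.Quotient.mk_smul, QuotSMulTop.mk_eq_zero_iff] at hm
  obtain ⟨m', hm'⟩ := hm
  obtain ⟨m'', rfl⟩ := hz.eq_of_smul_quotSMulTop hm'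
  rw [smul_comm] at hm'
  exact QuotSMulTop.mk_eq_zero_iff.mpr ⟨m'', hx hm'⟩

theorem HasTrivialSocle.of_isSMulRegular {x : A} (hx : x ∈ 𝔞) {M : Type*} [AddCommGroup M]
    [Module A M] (h : IsSMulRegular M x) : HasTrivialSocle 𝔞 M := fun _ hm =>
  h.right_eq_zero_of_smul (hm x hx)

theorem HasTrivialSocle.of_injective {M N : Type*} [AddCommGroup M] [Module A M] [AddCommGroup N]
    [Module A N] (f : M →ₗ[A] N) (hf : Function.Injective f) (h : HasTrivialSocle 𝔞 N) :
    HasTrivialSocle 𝔞 M := fun m hm =>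
  hf (by rw [map_zero]; exact h _ fun a ha => by rw [← map_smul, hm a ha, map_zero])

theorem HasTrivialSocle.prod {M N : Type*} [AddCommGroup M] [Module A M] [AddCommGroup N]
    [Module A N] (hM : HasTrivialSocle 𝔞 M) (hN : HasTrivialSocle 𝔞 N) :
    HasTrivialSocle 𝔞 (M × N) := fun _ hm =>
  Prod.ext (hM _ fun a ha => congrArg Prod.fst (hm a ha))
    (hN _ fun a ha => congrArg Prod.snd (hm a ha))

theorem IsSMulRegular.of_prod {x : A} {M N : Type*} [AddCommGroup M] [Module A M] [AddCommGroup N]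
    [Module A N] (h : IsSMulRegular (M × N) x) : IsSMulRegular M x ∧ IsSMulRegular N x :=
  ⟨h.of_injective (LinearMap.inl A M N) LinearMap.inl_injective,
    h.of_injective (LinearMap.inr A M N) LinearMap.inr_injective⟩

/-- An elementary form of Hom(A/𝔞, M/xM) ≅ Ext¹(A/𝔞, M) ≅ Hom(A/𝔞, M/yM): a socle element m of M/xM
satisfies y m = x m', and m' is a socle element of M/yM. -/
theorem HasTrivialSocle.quotSMulTop {x y : A} {M : Type*} [AddCommGroup M] [Module A M]
    (hx : IsSMulRegular M x) (hya : y ∈ 𝔞) (hy : IsSMulRegular M y)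
    (h : HasTrivialSocle 𝔞 (QuotSMulTop y M)) : HasTrivialSocle 𝔞 (QuotSMulTop x M) := by
  intro m hm
  obtain ⟨m, rfl⟩ := Submodule.Quotient.mk_surjective _ m
  simp_rw [← Submodule.Quotient.mk_smul, QuotSMulTop.mk_eq_zero_iff] at hm
  obtain ⟨m', hm'⟩ := hm y hya
  obtain ⟨m'', rfl⟩ := QuotSMulTop.mk_eq_zero_iff.mp <| h (Submodule.Quotient.mk m') fun a ha => by
    obtain ⟨l, hl⟩ := hm a ha
    rw [← Submodule.Quotient.mk_smul, QuotSMulTop.mk_eq_zero_iff]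
    refine ⟨l, hx ?_⟩
    change x • y • l = x • a • m'
    rw [smul_comm x y, hl, smul_comm x a, hm', smul_comm]
  rw [smul_comm] at hm'
  exact QuotSMulTop.mk_eq_zero_iff.mpr ⟨m'', hy hm'⟩

variable [IsNoetherianRing A]

/-- Prime avoidance: if no nonzero element is annihilated by `𝔞`, then `𝔞` contains a regular
element. -/
theorem HasTrivialSocle.exists_isSMulRegular {M : Type*} [AddCommGroup M] [Module A M]
    [Module.Finite A M] (h : HasTrivialSocle 𝔞 M) : ∃ x ∈ 𝔞, IsSMulRegular M x := by
  by_contra! hx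
  have hsub : (𝔞 : Set A) ⊆ ⋃ p ∈ associatedPrimes A M, p := by
    rw [biUnion_associatedPrimes_eq_compl_regular]
    exact hx
  -- Prime avoidance tolerates two non-prime indices; here every ideal is prime, so the two zeros
  -- are arbitrary.
  obtain ⟨p, hp, hle⟩ := (𝔞.subset_union_prime_finite (associatedPrimes.finite A M) (f := id) 0 0
    fun _ h _ _ => h.isPrime).1 hsub
  obtain ⟨hprime, m, hm⟩ := isAssociatedPrime_iff.mp hp
  refine hprime.ne_top ?_
  have hm0 : m = 0 := h m fun a ha => by
    have : a ∈ p := hle ha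
    rw [hm] at this
    simpa using this
  rw [hm, hm0]
  ext
  simp

theorem hasRegularSequence_one_iff {M : Type*} [AddCommGroup M] [Module A M]
    [Module.Finite A M] : HasRegularSequence 𝔞 1 M ↔ HasTrivialSocle 𝔞 M := by
  rw [show (1 : ℕ) = 0 + 1 from rfl, hasRegularSequence_succ_iff]
  constructor
  · rintro ⟨x, hx, hreg, -⟩
    exact .of_isSMulRegular hx hreg
  · intro h
    obtain ⟨x, hx, hreg⟩ := h.exists_isSMulRegular
    exact ⟨x, hx, hreg, hasRegularSequence_zero _⟩

/-- Any regular element of `𝔞` can be chosen as the first element of a regular sequence of maximal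
length. -/
theorem HasRegularSequence.quotSMulTop {n : ℕ} : ∀ {M : Type u} [AddCommGroup M] [Module A M]
    [Module.Finite A M] {x : A}, x ∈ 𝔞 → IsSMulRegular M x → HasRegularSequence 𝔞 (n + 1) M →
    HasRegularSequence 𝔞 n (QuotSMulTop x M) := by
  induction n with
  | zero => intros; exact hasRegularSequence_zero _
  | succ n ih =>
    intro M _ _ _ x hx hreg h
    obtain ⟨y, hy, hyreg, hM⟩ := hasRegularSequence_succ_iff.mp h
    have hsy : HasTrivialSocle 𝔞 (QuotSMulTop y M) :=
      hasRegularSequence_one_iff.mp (hM.mono (by omega))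
    have hsx : HasTrivialSocle 𝔞 (QuotSMulTop x M) := hsy.quotSMulTop hreg hy hyreg
    -- Exchange: `z` is regular on M, M/xM and M/yM simultaneously, by prime avoidance on their
    -- product, so it can replace `y` as first element and then be swapped with `x`.
    obtain ⟨z, hz, hzreg⟩ :=
      ((HasTrivialSocle.of_isSMulRegular hx hreg).prod (hsx.prod hsy)).exists_isSMulRegular
    obtain ⟨hzM, hzxy⟩ := hzreg.of_prod
    obtain ⟨hzx, hzy⟩ := hzxy.of_prod
    have h1 : HasRegularSequence 𝔞 n (QuotSMulTop y (QuotSMulTop z M)) :=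
      (ih hz hzy hM).congr (quotSMulTopComm z y M)
    have h2 : HasRegularSequence 𝔞 (n + 1) (QuotSMulTop z M) :=
      hasRegularSequence_succ_iff.mpr ⟨y, hy, hyreg.quotSMulTop_swap hzy, h1⟩
    have h3 := ih hx (hreg.quotSMulTop_swap hzx) h2
    exact hasRegularSequence_succ_iff.mpr ⟨z, hz, hzx, h3.congr (quotSMulTopComm x z M)⟩

theorem hasRegularSequence_quotSMulTop_iff {n : ℕ} {M : Type*} [AddCommGroup M] [Module A M]
    [Module.Finite A M] {x : A} (hx : x ∈ 𝔞) (hreg : IsSMulRegular M x) :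
    HasRegularSequence 𝔞 n (QuotSMulTop x M) ↔ HasRegularSequence 𝔞 (n + 1) M :=
  ⟨fun h => hasRegularSequence_succ_iff.mpr ⟨x, hx, hreg, h⟩, fun h => h.quotSMulTop hx hreg⟩

end Depth

/-! ### Depth along the two exact sequences -/

section ExactSequences

universe u

variable {A : Type*} [CommRing A] {𝔞 : Ideal A}

/-- By the snake lemma the kernel is a quotient of the x-torsion of P. -/
theorem QuotSMulTop.map_injective_of_exact {x : A} {M N P : Type*} [AddCommGroup M] [Module A M]
    [AddCommGroup N] [Module A N] [AddCommGroup P] [Module A P] {f : M →ₗ[A] N} {g : N →ₗ[A] P}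
    (hf : Function.Injective f) (hfg : Function.Exact f g) (hx : IsSMulRegular P x) :
    Function.Injective (QuotSMulTop.map x f) := by
  rw [injective_iff_map_eq_zero]
  intro m hm
  obtain ⟨m, rfl⟩ := Submodule.Quotient.mk_surjective _ m
  rw [QuotSMulTop.map_apply_mk, QuotSMulTop.mk_eq_zero_iff] at hm
  obtain ⟨n, hn⟩ := hm
  obtain ⟨m', rfl⟩ := (hfg n).mp <| hx.right_eq_zero_of_smul <| by
    rw [← map_smul, hn, hfg.apply_apply_eq_zero]
  rw [← map_smul] at hn
  exact QuotSMulTop.mk_eq_zero_iff.mpr ⟨m', hf hn⟩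

theorem QuotSMulTop.map_pow (x : A) {M : Type*} [AddCommGroup M] [Module A M]
    (f : Module.End A M) (k : ℕ) :
    (QuotSMulTop.map x f : Module.End A (QuotSMulTop x M)) ^ k = QuotSMulTop.map x (f ^ k) := by
  induction k with
  | zero => exact (QuotSMulTop.map_id x M).symm
  | succ k ih =>
    rw [pow_succ, pow_succ, ih]
    exact (QuotSMulTop.map_comp x _ _).symm

theorem QuotSMulTop.isNilpotent_map (x : A) {M : Type*} [AddCommGroup M] [Module A M]
    {f : Module.End A M} (hf : IsNilpotent f) :
    IsNilpotent (QuotSMulTop.map x f : Module.End A (QuotSMulTop x M)) := by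
  obtain ⟨k, hk⟩ := hf
  exact ⟨k, by rw [QuotSMulTop.map_pow, hk, map_zero]⟩

theorem Module.Finite.of_exact_of_isNoetherianRing [IsNoetherianRing A] {M N P : Type*}
    [AddCommGroup M] [Module A M] [Module.Finite A M] [AddCommGroup N] [Module A N]
    [AddCommGroup P] [Module A P] [Module.Finite A P] {f : M →ₗ[A] N} {g : N →ₗ[A] P}
    (hfg : Function.Exact f g) : Module.Finite A N :=
  have := isNoetherian_of_range_eq_ker f g hfg.linearMap_ker_eq.symm
  inferInstance

theorem HasTrivialSocle.of_exact {M N P : Type*} [AddCommGroup M] [Module A M]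
    [AddCommGroup N] [Module A N] [AddCommGroup P] [Module A P] {f : M →ₗ[A] N} {g : N →ₗ[A] P}
    (hf : Function.Injective f) (hfg : Function.Exact f g) (hM : HasTrivialSocle 𝔞 M)
    (hP : HasTrivialSocle 𝔞 P) : HasTrivialSocle 𝔞 N := by
  intro n hn
  obtain ⟨m, rfl⟩ := (hfg n).mp <| hP _ fun a ha => by rw [← map_smul, hn a ha, map_zero]
  rw [hM m fun a ha => hf (by rw [map_smul, hn a ha, map_zero]), map_zero]

/-- If `0 → M → E → F → 0` is exact, `M` has no socle and `F → E → F` is nilpotent with `F → E`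
injective, then `F` has no socle. -/
theorem HasTrivialSocle.of_isNilpotent {M E F : Type*} [AddCommGroup M] [Module A M]
    [AddCommGroup E] [Module A E] [AddCommGroup F] [Module A F] {ι : M →ₗ[A] E} {β : E →ₗ[A] F}
    {α : F →ₗ[A] E} (hι : Function.Injective ι) (hιβ : Function.Exact ι β)
    (hα : Function.Injective α) (hnil : IsNilpotent (β ∘ₗ α : Module.End A F))
    (hM : HasTrivialSocle 𝔞 M) : HasTrivialSocle 𝔞 F := by
  obtain ⟨k, hk⟩ := hnil
  have key : ∀ j (m : F), (∀ a ∈ 𝔞, a • m = 0) → ((β ∘ₗ α : Module.End A F) ^ j) m = 0 →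
      m = 0 := by
    intro j
    induction j with
    | zero => exact fun m _ hm => hm
    | succ j ih =>
      intro m hsoc hm
      rw [pow_succ, Module.End.mul_apply] at hm
      -- β(α m) is again a socle element, killed by one power less; once it vanishes, α m comes from
      -- the socle of M.
      have h0 : β (α m) = 0 := ih _ (fun a ha => by rw [← map_smul, ← map_smul, hsoc a ha, map_zero, map_zero]) hm
      obtain ⟨n, hn⟩ := (hιβ _).mp h0
      have hn0 : n = 0 := hM n fun a ha => hι (by
        rw [map_smul, hn, ← map_smul, hsoc a ha, map_zero, map_zero])
      rw [hn0, map_zero] at hn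
      exact hα (by rw [← hn, map_zero])
  exact fun m hm => key k m hm (by rw [hk, LinearMap.zero_apply])

/-- The connecting map Hom(A/𝔞, P) → Ext¹(A/𝔞, M) by hand: lift a socle element of P to n in N; then
x n lies in M and defines a socle element of M/xM. -/
theorem HasTrivialSocle.of_quotSMulTop {x : A} {M N P : Type*} [AddCommGroup M] [Module A M]
    [AddCommGroup N] [Module A N] [AddCommGroup P] [Module A P] {f : M →ₗ[A] N} {g : N →ₗ[A] P}
    (hf : Function.Injective f) (hfg : Function.Exact f g) (hg : Function.Surjective g)
    (hxa : x ∈ 𝔞) (hx : IsSMulRegular N x)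
    (hM : HasTrivialSocle 𝔞 (QuotSMulTop x M)) : HasTrivialSocle 𝔞 P := by
  intro p hp
  obtain ⟨n, rfl⟩ := hg p
  have lift : ∀ a ∈ 𝔞, ∃ m, f m = a • n := fun a ha =>
    (hfg _).mp (by rw [map_smul, hp a ha])
  obtain ⟨m, hm⟩ := lift x hxa
  obtain ⟨m', rfl⟩ := QuotSMulTop.mk_eq_zero_iff.mp <| hM (Submodule.Quotient.mk m) fun a ha => by
    obtain ⟨l, hl⟩ := lift a ha
    rw [← Submodule.Quotient.mk_smul, QuotSMulTop.mk_eq_zero_iff]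
    exact ⟨l, hf (by rw [map_smul, map_smul, hl, hm, smul_comm])⟩
  rw [map_smul] at hm
  rw [← hx hm, hfg.apply_apply_eq_zero]

/-- Let `0 → M → E → F → 0` and `0 → F → E → G → 0` be exact sequences of finite modules such that
the composition `F → E → F` is nilpotent. If `depth G = n < depth M`, then
`depth F = n + 1`. -/
theorem hasRegularSequence_of_isNilpotent [IsNoetherianRing A] (n : ℕ) :
    ∀ {M E F G : Type u} [AddCommGroup M] [Module A M] [Module.Finite A M]
    [AddCommGroup E] [Module A E] [Module.Finite A E] [AddCommGroup F] [Module A F]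
    [Module.Finite A F] [AddCommGroup G] [Module A G] [Module.Finite A G]
    {ι : M →ₗ[A] E} {β : E →ₗ[A] F} {α : F →ₗ[A] E} {π : E →ₗ[A] G},
    Function.Injective ι → Function.Exact ι β → Function.Surjective β →
    Function.Injective α → Function.Exact α π → Function.Surjective π →
    IsNilpotent (β ∘ₗ α : Module.End A F) →
    HasRegularSequence 𝔞 (n + 1) M → HasRegularSequence 𝔞 n G →
    ¬ HasRegularSequence 𝔞 (n + 1) G →
    HasRegularSequence 𝔞 (n + 1) F ∧ ¬ HasRegularSequence 𝔞 (n + 2) F := by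
  induction n with
  | zero =>
    intro M E F G _ _ _ _ _ _ _ _ _ _ _ _ ι β α π hι hιβ hβ hα hαπ hπ hnil hM hG hG'
    rw [zero_add, hasRegularSequence_one_iff] at hM hG' ⊢
    have hF : HasTrivialSocle 𝔞 F := .of_isNilpotent hι hιβ hα hnil hM
    have hE : HasTrivialSocle 𝔞 E := .of_exact hι hιβ hM hF
    refine ⟨hF, fun h2 => hG' ?_⟩
    obtain ⟨x, hx, hreg⟩ := (hF.prod hE).exists_isSMulRegular
    refine .of_quotSMulTop hα hαπ hπ hx hreg.of_prod.2 ?_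
    rw [← hasRegularSequence_one_iff]
    exact h2.quotSMulTop hx hreg.of_prod.1
  | succ n ih =>
    intro M E F G _ _ _ _ _ _ _ _ _ _ _ _ ι β α π hι hιβ hβ hα hαπ hπ hnil hM hG hG'
    have hsM : HasTrivialSocle 𝔞 M := hasRegularSequence_one_iff.mp (hM.mono (by omega))
    have hsG : HasTrivialSocle 𝔞 G := hasRegularSequence_one_iff.mp (hG.mono (by omega))
    have hsF : HasTrivialSocle 𝔞 F := .of_isNilpotent hι hιβ hα hnil hsM
    -- Regularity on F and G keeps both sequences exact modulo `x`; regularity on M, F and G makes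
    -- all three depths drop by one.
    obtain ⟨x, hx, hreg⟩ := (hsM.prod (hsF.prod hsG)).exists_isSMulRegular
    obtain ⟨hxM, hxFG⟩ := hreg.of_prod
    obtain ⟨hxF, hxG⟩ := hxFG.of_prod
    rw [← hasRegularSequence_quotSMulTop_iff hx ‹_›] at hM hG hG' ⊢
    rw [← hasRegularSequence_quotSMulTop_iff (n := n + 2) hx hxF]
    refine ih (QuotSMulTop.map_injective_of_exact hι hιβ hxF)
      (QuotSMulTop.map_exact x hιβ hβ) (QuotSMulTop.map_surjective x hβ)
      (QuotSMulTop.map_injective_of_exact hα hαπ hxG)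
      (QuotSMulTop.map_exact x hαπ hπ) (QuotSMulTop.map_surjective x hπ) ?_ hM hG hG'
    rw [← QuotSMulTop.map_comp]
    exact QuotSMulTop.isNilpotent_map x hnil

end ExactSequences

/-! ### Change of rings -/

section ChangeOfRings

variable {A B : Type*} [CommRing A] [CommRing B] {𝔞 : Ideal A} {𝔟 : Ideal B}

open scoped Pointwise in
/-- If `e : M ≃+ N` is semilinear along `σ`, then so is the induced map `M / xM ≃+ N / σ(x)N`. -/
theorem exists_quotSMulTop_addEquiv {σ : A →+* B} {M N : Type*} [AddCommGroup M] [Module A M]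
    [AddCommGroup N] [Module B N] (e : M ≃+ N) (he : ∀ (a : A) (m : M), e (a • m) = σ a • e m)
    (x : A) : ∃ e' : QuotSMulTop x M ≃+ QuotSMulTop (σ x) N,
      ∀ (a : A) (m : QuotSMulTop x M), e' (a • m) = σ a • e' m := by
  refine ⟨QuotientAddGroup.congr _ _ e ?_, fun a m => ?_⟩
  · ext n
    simp only [AddSubgroup.mem_map, Submodule.mem_toAddSubgroup,
      Submodule.mem_smul_pointwise_iff_exists, Submodule.mem_top, true_and]
    constructor
    · rintro ⟨_, ⟨m, rfl⟩, rfl⟩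
      exact ⟨e m, (he x m).symm⟩
    · rintro ⟨n, rfl⟩
      exact ⟨x • e.symm n, ⟨_, rfl⟩, by simp [he]⟩
  · obtain ⟨m, rfl⟩ := Submodule.Quotient.mk_surjective _ m
    exact congrArg (Submodule.Quotient.mk (p := σ x • (⊤ : Submodule B N))) (he a m)

theorem HasTrivialSocle.of_le_radical [IsNoetherianRing B] {N : Type*} [AddCommGroup N]
    [Module B N] {𝔠 : Ideal B} (h𝔟 : 𝔟 ≤ 𝔠.radical) (h : HasTrivialSocle 𝔟 N) :
    HasTrivialSocle 𝔠 N := by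
  intro m hm
  obtain ⟨k, hk⟩ := Ideal.exists_pow_le_of_le_radical_of_fg h𝔟 (IsNoetherian.noetherian 𝔟)
  have key : ∀ j, ∀ m : N, (∀ b ∈ 𝔟 ^ j, b • m = 0) → m = 0 := by
    intro j
    induction j with
    | zero => exact fun m hm => by simpa using hm 1 (by simp)
    | succ j ih =>
      refine fun m hm => ih m fun b hb => h _ fun c hc => ?_
      rw [smul_smul, hm _ (by rw [pow_succ']; exact Ideal.mul_mem_mul hc hb)]
  exact key k m fun b hb => hm b (hk hb)

/-- Elements of 𝔟 need not come from A, so a sequence in 𝔟 cannot be pulled back directly. Trivial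
socles can: they depend on 𝔟 only up to radical. This gives a regular x in 𝔞, and σ x may then start
a sequence in 𝔟 of the same length. -/
theorem hasRegularSequence_iff_of_semilinear [IsNoetherianRing A] [IsNoetherianRing B]
    {σ : A →+* B} (h𝔞 : 𝔞.map σ ≤ 𝔟) (h𝔟 : 𝔟 ≤ (𝔞.map σ).radical) (n : ℕ) :
    ∀ {M N : Type*} [AddCommGroup M] [Module A M] [Module.Finite A M]
    [AddCommGroup N] [Module B N] [Module.Finite B N] (e : M ≃+ N)
    (_ : ∀ (a : A) (m : M), e (a • m) = σ a • e m),
    HasRegularSequence 𝔞 n M ↔ HasRegularSequence 𝔟 n N := by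
  induction n with
  | zero => exact fun _ _ => ⟨fun _ => hasRegularSequence_zero _, fun _ => hasRegularSequence_zero _⟩
  | succ n ih =>
    intro M N _ _ _ _ _ _ e he
    have hreg (x : A) : IsSMulRegular M x ↔ IsSMulRegular N (σ x) :=
      e.toEquiv.isSMulRegular_congr (he x)
    have hσ {x : A} (hx : x ∈ 𝔞) : σ x ∈ 𝔟 := h𝔞 (Ideal.mem_map_of_mem σ hx)
    suffices hsocle : HasTrivialSocle 𝔟 N → HasTrivialSocle 𝔞 M by
      constructor
      · intro h
        obtain ⟨x, hx, hxreg, hM⟩ := hasRegularSequence_succ_iff.mp h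
        obtain ⟨e', he'⟩ := exists_quotSMulTop_addEquiv e he x
        exact hasRegularSequence_succ_iff.mpr ⟨σ x, hσ hx, (hreg x).mp hxreg, (ih e' he').mp hM⟩
      · intro h
        obtain ⟨x, hx, hxreg⟩ := (hsocle <| hasRegularSequence_one_iff.mp <|
          h.mono (by omega)).exists_isSMulRegular
        obtain ⟨e', he'⟩ := exists_quotSMulTop_addEquiv e he x
        exact hasRegularSequence_succ_iff.mpr ⟨x, hx, hxreg,
          (ih e' he').mpr (h.quotSMulTop (hσ hx) ((hreg x).mp hxreg))⟩
    intro h m hm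
    refine e.map_eq_zero_iff.mp (h.of_le_radical h𝔟 (e m) fun b hb => ?_)
    have hle : 𝔞.map σ ≤ LinearMap.ker (LinearMap.toSpanSingleton B N (e m)) :=
      Ideal.map_le_iff_le_comap.mpr fun a ha => by
        rw [Ideal.mem_comap, LinearMap.mem_ker, LinearMap.toSpanSingleton_apply, ← he, hm a ha,
          map_zero]
    exact hle hb

end ChangeOfRings

/-! ### Rees algebras and fiber cones over R[(I₁ ∩ I₂)t] -/

section Rees

universe u

variable {R : Type u} [CommRing R]

theorem pow_succ_eq_mul_of_le {K I : Ideal R} {N : ℕ} (h : I ^ (N + 1) = K * I ^ N) {m : ℕ}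
    (hm : N ≤ m) : I ^ (m + 1) = K * I ^ m := by
  obtain ⟨k, rfl⟩ := Nat.exists_eq_add_of_le hm
  rw [add_right_comm, pow_add, h, mul_assoc, ← pow_add]

/-- The degree `n` component `Iⁿ tⁿ` of the Rees algebra. -/
noncomputable def reesMonomial (I : Ideal R) (n : ℕ) : (I ^ n : Ideal R) →ₗ[R] reesAlgebra I :=
  ((monomial n).comp (Submodule.subtype (I ^ n))).codRestrict
    (Subalgebra.toSubmodule (reesAlgebra I)) fun r => reesAlgebra.monomial_mem.mpr r.2

@[simp]
theorem coe_reesMonomial (I : Ideal R) (n : ℕ) (r : (I ^ n : Ideal R)) :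
    (reesMonomial I n r : R[X]) = monomial n (r : R) := rfl

theorem eq_sum_reesMonomial {I : Ideal R} (b : reesAlgebra I) :
    b = ∑ n ∈ (b : R[X]).support, reesMonomial I n ⟨(b : R[X]).coeff n, b.2 n⟩ := by
  apply Subtype.ext
  rw [AddSubmonoidClass.coe_finsetSum]
  exact (b : R[X]).as_sum_support

/-- The inclusion of Rees algebras `R[(I₁ ∩ I₂)t] ⊆ R[I₂t]`. -/
noncomputable instance reesAlgebraInfAlgebra (I₁ I₂ : Ideal R) :
    Algebra (reesAlgebra (I₁ ⊓ I₂)) (reesAlgebra I₂) :=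
  (Subalgebra.inclusion (S := reesAlgebra (I₁ ⊓ I₂)) (T := reesAlgebra I₂)
    fun _ hf n => Ideal.pow_right_mono inf_le_right n (hf n)).toRingHom.toAlgebra

@[simp]
theorem coe_algebraMap_reesAlgebra {I₁ I₂ : Ideal R} (a : reesAlgebra (I₁ ⊓ I₂)) :
    (algebraMap (reesAlgebra (I₁ ⊓ I₂)) (reesAlgebra I₂) a : R[X]) = a := rfl

@[simp]
theorem coe_smul_reesAlgebra {I₁ I₂ : Ideal R} (a : reesAlgebra (I₁ ⊓ I₂)) (b : reesAlgebra I₂) :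
    ((a • b : reesAlgebra I₂) : R[X]) = a * b := rfl

noncomputable instance fiberConeAlgebra (I₁ I₂ I : Ideal R) :
    Algebra (reesAlgebra (I₁ ⊓ I₂)) (FiberCone I I₂) :=
  Ideal.Quotient.algebra _

noncomputable instance fiberConeModule (I₁ I₂ I : Ideal R) :
    Module (reesAlgebra (I₁ ⊓ I₂)) (FiberCone I I₂) :=
  Algebra.toModule

theorem smul_mk_fiberCone {I₁ I₂ I : Ideal R} (a : reesAlgebra (I₁ ⊓ I₂)) (b : reesAlgebra I₂) :
    a • Ideal.Quotient.mk (fiberIdeal I I₂) b = Ideal.Quotient.mk (fiberIdeal I I₂) (a • b) :=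
  rfl

variable {I₁ I₂ : Ideal R}

/-- In degrees beyond `N`, the Rees algebra of `I₂` is generated over that of `I₁ ∩ I₂` by the
component of degree one less. -/
theorem reesMonomial_succ_mem (m : ℕ) (hm : I₂ ^ (m + 1) = (I₁ ⊓ I₂) * I₂ ^ m)
    (S : Submodule (reesAlgebra (I₁ ⊓ I₂)) (reesAlgebra I₂))
    (hS : ∀ (c : (I₁ ⊓ I₂ : Ideal R)) (d : (I₂ ^ m : Ideal R)),
      reesMonomial (I₁ ⊓ I₂) 1 ⟨c, by simp⟩ • reesMonomial I₂ m d ∈ S)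
    (r : (I₂ ^ (m + 1) : Ideal R)) : reesMonomial I₂ (m + 1) r ∈ S := by
  obtain ⟨r, hr⟩ := r
  have key : ∀ x ∈ (I₁ ⊓ I₂) * I₂ ^ m, ∃ s ∈ S, (s : R[X]) = monomial (m + 1) x := by
    intro x hx
    induction hx using Submodule.mul_induction_on' with
    | mem_mul_mem c hc d hd =>
      refine ⟨_, hS ⟨c, hc⟩ ⟨d, hd⟩, ?_⟩
      simp [monomial_mul_monomial, add_comm]
    | add x _ y _ ihx ihy =>
      obtain ⟨s, hs, hsx⟩ := ihx
      obtain ⟨t, ht, hty⟩ := ihy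
      exact ⟨s + t, S.add_mem hs ht, by simp [hsx, hty]⟩
  obtain ⟨s, hs, hsr⟩ := key r (hm ▸ hr)
  rwa [show reesMonomial I₂ (m + 1) ⟨r, hr⟩ = s from Subtype.ext hsr.symm]

/-- Finitely many R-generators of I₂ⁿ tⁿ for n ≤ N suffice, since multiplication by (I₁ ∩ I₂)t
produces each higher degree from the previous one. -/
theorem finite_reesAlgebra_of_pow_eq [IsNoetherianRing R] {N : ℕ}
    (hN : I₂ ^ (N + 1) = (I₁ ⊓ I₂) * I₂ ^ N) :
    Module.Finite (reesAlgebra (I₁ ⊓ I₂)) (reesAlgebra I₂) := by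
  choose s hs using fun n => (Module.Finite.fg_top : (⊤ : Submodule R (I₂ ^ n : Ideal R)).FG)
  let T : Set (reesAlgebra I₂) :=
    ⋃ n ∈ Finset.range (N + 1), reesMonomial I₂ n '' (s n : Set (I₂ ^ n : Ideal R))
  have hT : T.Finite := Set.Finite.biUnion (Finset.finite_toSet _) fun n _ =>
    (s n).finite_toSet.image _
  let S := Submodule.span (reesAlgebra (I₁ ⊓ I₂)) T
  have hsmall : ∀ n ≤ N, ∀ r : (I₂ ^ n : Ideal R), reesMonomial I₂ n r ∈ S := by
    intro n hn r
    have hr : r ∈ Submodule.span R (s n : Set (I₂ ^ n : Ideal R)) := by rw [hs]; trivial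
    induction hr using Submodule.span_induction with
    | mem r hr =>
      exact Submodule.subset_span (Set.mem_biUnion (Finset.mem_coe.mpr
        (Finset.mem_range_succ_iff.mpr hn)) ⟨r, hr, rfl⟩)
    | zero => rw [map_zero]; exact S.zero_mem
    | add x y _ _ hx hy => rw [map_add]; exact S.add_mem hx hy
    | smul c x _ hx =>
      rw [map_smul, show c • reesMonomial I₂ n x =
        algebraMap R (reesAlgebra (I₁ ⊓ I₂)) c • reesMonomial I₂ n x from
          Subtype.ext (by simp [Algebra.smul_def])]
      exact S.smul_mem _ hx
  have hmon : ∀ n (r : (I₂ ^ n : Ideal R)), reesMonomial I₂ n r ∈ S := by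
    intro n
    induction n with
    | zero => exact hsmall 0 N.zero_le
    | succ n ih =>
      by_cases hn : n + 1 ≤ N
      · exact hsmall _ hn
      · exact reesMonomial_succ_mem n (pow_succ_eq_mul_of_le hN (by omega)) S
          fun c d => S.smul_mem _ (ih d)
  refine ⟨Submodule.fg_def.mpr ⟨T, hT, eq_top_iff.mpr fun b _ => ?_⟩⟩
  rw [eq_sum_reesMonomial b]
  exact S.sum_mem fun n _ => hmon n _

variable (I₁ I₂) in
theorem map_reesMaximalIdeal_le [IsLocalRing R] :
    (reesMaximalIdeal (I₁ ⊓ I₂)).map (algebraMap (reesAlgebra (I₁ ⊓ I₂)) (reesAlgebra I₂)) ≤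
      reesMaximalIdeal I₂ :=
  Ideal.map_le_iff_le_comap.mpr fun _ ha => ha

/-- The homogeneous maximal ideals of the Rees algebras of `I₁ ∩ I₂` and of `I₂` have the same
radical. -/
theorem reesMaximalIdeal_le_radical [IsLocalRing R] {N : ℕ}
    (hN : I₂ ^ (N + 1) = (I₁ ⊓ I₂) * I₂ ^ N) :
    reesMaximalIdeal I₂ ≤ ((reesMaximalIdeal (I₁ ⊓ I₂)).map
      (algebraMap (reesAlgebra (I₁ ⊓ I₂)) (reesAlgebra I₂))).radical := by
  set P := (reesMaximalIdeal (I₁ ⊓ I₂)).map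
    (algebraMap (reesAlgebra (I₁ ⊓ I₂)) (reesAlgebra I₂)) with hP
  have hbig : ∀ m, N ≤ m → ∀ r : (I₂ ^ (m + 1) : Ideal R), reesMonomial I₂ (m + 1) r ∈ P := by
    intro m hm r
    refine reesMonomial_succ_mem m (pow_succ_eq_mul_of_le hN hm)
      (P.restrictScalars (reesAlgebra (I₁ ⊓ I₂))) (fun c d => ?_) r
    rw [Submodule.restrictScalars_mem, Algebra.smul_def]
    refine P.mul_mem_right _ (Ideal.mem_map_of_mem _ ?_)
    change (monomial 1 (c : R)).coeff 0 ∈ IsLocalRing.maximalIdeal R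
    simp [coeff_monomial]
  intro b hb
  rw [eq_sum_reesMonomial b]
  refine Ideal.sum_mem _ fun n _ => ?_
  obtain _ | n := n
  · refine Ideal.le_radical ?_
    have : reesMonomial I₂ 0 ⟨(b : R[X]).coeff 0, b.2 0⟩ =
        algebraMap (reesAlgebra (I₁ ⊓ I₂)) (reesAlgebra I₂)
          (algebraMap R (reesAlgebra (I₁ ⊓ I₂)) ((b : R[X]).coeff 0)) := Subtype.ext rfl
    rw [this]
    refine Ideal.mem_map_of_mem _ ?_
    change (C ((b : R[X]).coeff 0)).coeff 0 ∈ IsLocalRing.maximalIdeal R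
    rw [coeff_C_zero]
    exact hb
  -- The power N + 1 puts a monomial of degree n + 1 in degree (n + 1)(N + 1) > N, where `hbig`
  -- applies.
  · refine ⟨N + 1, ?_⟩
    have hmem : (b : R[X]).coeff (n + 1) ^ (N + 1) ∈ I₂ ^ ((n * (N + 1) + N) + 1) := by
      rw [show n * (N + 1) + N + 1 = (n + 1) * (N + 1) by ring, pow_mul]
      exact Ideal.pow_mem_pow (b.2 (n + 1)) _
    have : reesMonomial I₂ (n + 1) ⟨(b : R[X]).coeff (n + 1), b.2 (n + 1)⟩ ^ (N + 1) =
        reesMonomial I₂ (n * (N + 1) + N + 1) ⟨_, hmem⟩ := by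
      apply Subtype.ext
      rw [SubmonoidClass.coe_pow, coe_reesMonomial, monomial_pow, coe_reesMonomial,
        show (n + 1) * (N + 1) = n * (N + 1) + N + 1 by ring]
    rw [this]
    exact hbig _ (Nat.le_add_left _ _) _

variable (I₁ I₂) in
/-- The projection of the Rees algebra of `I₂` onto `F_I(I₂)`. -/
noncomputable def fiberConeMk (I : Ideal R) :
    reesAlgebra I₂ →ₗ[reesAlgebra (I₁ ⊓ I₂)] FiberCone I I₂ where
  toFun := Ideal.Quotient.mk (fiberIdeal I I₂)
  map_add' := map_add _
  map_smul' a b := (smul_mk_fiberCone a b).symm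

variable (I₁ I₂) in
theorem fiberConeMk_surjective (I : Ideal R) : Function.Surjective (fiberConeMk I₁ I₂ I) :=
  Ideal.Quotient.mk_surjective

theorem finite_fiberCone_of_pow_eq [IsNoetherianRing R] {N : ℕ}
    (hN : I₂ ^ (N + 1) = (I₁ ⊓ I₂) * I₂ ^ N) (I : Ideal R) :
    Module.Finite (reesAlgebra (I₁ ⊓ I₂)) (FiberCone I I₂) :=
  have := finite_reesAlgebra_of_pow_eq hN
  .of_surjective (fiberConeMk I₁ I₂ I) (fiberConeMk_surjective I₁ I₂ I)

/-- The fiber cone `F_I(I₂)` has the same lengths of regular sequences over the Rees algebra of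
`I₁ ∩ I₂` as over itself. -/
theorem hasRegularSequence_fiberCone_iff [IsLocalRing R] [IsNoetherianRing R] {N : ℕ}
    (hN : I₂ ^ (N + 1) = (I₁ ⊓ I₂) * I₂ ^ N) (I : Ideal R) (n : ℕ) :
    HasRegularSequence (reesMaximalIdeal (I₁ ⊓ I₂)) n (FiberCone I I₂) ↔
      HasRegularSequence ((reesMaximalIdeal I₂).map (Ideal.Quotient.mk (fiberIdeal I I₂))) n
        (FiberCone I I₂) := by
  have := finite_fiberCone_of_pow_eq hN I
  refine hasRegularSequence_iff_of_semilinear (σ := (Ideal.Quotient.mk (fiberIdeal I I₂)).comp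
    (algebraMap (reesAlgebra (I₁ ⊓ I₂)) (reesAlgebra I₂))) ?_ ?_ n (AddEquiv.refl (FiberCone I I₂))
    fun a m => ?_
  · rw [← Ideal.map_map]
    exact Ideal.map_mono (map_reesMaximalIdeal_le I₁ I₂)
  · rw [← Ideal.map_map]
    exact (Ideal.map_mono (reesMaximalIdeal_le_radical hN)).trans (Ideal.map_radical_le _)
  · exact Algebra.smul_def a m

section Sequences

theorem divX_mem_reesAlgebra {K I : Ideal R} (h : K ≤ I) {f : R[X]} (hf : f ∈ reesAlgebra K) :
    divX f ∈ reesAlgebra I := fun n => by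
  rw [coeff_divX]
  exact Ideal.pow_right_mono h n (Ideal.pow_le_pow_right n.le_succ (hf (n + 1)))

/-- The last term is the obstruction to linearity of division by t; it dies in F_I(I₂) as soon as I
contains I₁ ∩ I₂. -/
theorem divX_mul (f g : R[X]) : divX (f * g) = f * divX g + C (g.coeff 0) * divX f := by
  conv_lhs => rw [← divX_mul_X_add g]
  ext n
  rw [coeff_divX, mul_add, ← mul_assoc, coeff_add, coeff_mul_X, mul_comm f (C _), coeff_C_mul,
    coeff_add, coeff_C_mul, coeff_divX]

variable (I₁ I₂)

/-- `R ⊕ ⨁_{n ≥ 1} I₂ⁿ⁻¹ tⁿ` as a module over the Rees algebra of `I₁ ∩ I₂`. -/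
def reesModuleShift : Submodule (reesAlgebra (I₁ ⊓ I₂)) R[X] where
  carrier := { f | divX f ∈ reesAlgebra I₂ }
  add_mem' {f g} hf hg := by
    simpa only [Set.mem_ofPred_eq, divX_add] using add_mem hf hg
  zero_mem' := by simp
  smul_mem' c f hf := by
    rw [Set.mem_ofPred_eq, Subalgebra.smul_def, smul_eq_mul, divX_mul]
    exact add_mem (mul_mem (algebraMap (reesAlgebra (I₁ ⊓ I₂)) (reesAlgebra I₂) c).2 hf)
      (mul_mem ((reesAlgebra I₂).algebraMap_mem _) (divX_mem_reesAlgebra inf_le_right c.2))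

variable {I₁ I₂}

theorem mem_reesModuleShift_iff {f : R[X]} :
    f ∈ reesModuleShift I₁ I₂ ↔ divX f ∈ reesAlgebra I₂ := Iff.rfl

theorem mem_fiberIdeal_iff {I : Ideal R} {b : reesAlgebra I₂} :
    b ∈ fiberIdeal I I₂ ↔ ∀ n, (b : R[X]).coeff n ∈ I * I₂ ^ n := Iff.rfl

/-- Division by `t` as a map `R ⊕ ⨁_{n ≥ 1} I₂ⁿ⁻¹ tⁿ → F_I(I₂)`. -/
noncomputable def divXFiberCone {I : Ideal R} (hI : I₁ ⊓ I₂ ≤ I) :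
    reesModuleShift I₁ I₂ →ₗ[reesAlgebra (I₁ ⊓ I₂)] FiberCone I I₂ where
  toFun f := Ideal.Quotient.mk _ ⟨divX f, f.2⟩
  map_add' f g := by
    rw [← map_add]
    exact congrArg _ (Subtype.ext divX_add)
  map_smul' a f := by
    refine (Ideal.Quotient.eq.mpr ?_).trans (smul_mk_fiberCone a _).symm
    rw [mem_fiberIdeal_iff]
    intro n
    change (divX ((a : R[X]) * (f : R[X])) - (a : R[X]) * divX (f : R[X])).coeff n ∈ _
    rw [divX_mul, add_sub_cancel_left, coeff_C_mul, coeff_divX]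
    refine Ideal.mul_mem_left _ _ ?_
    have := a.2 (n + 1)
    rw [pow_succ'] at this
    exact Ideal.mul_mono hI (Ideal.pow_right_mono inf_le_right n) this

theorem divXFiberCone_eq_zero_iff {I : Ideal R} (hI : I₁ ⊓ I₂ ≤ I)
    (f : reesModuleShift I₁ I₂) :
    divXFiberCone hI f = 0 ↔ ∀ n, (f : R[X]).coeff (n + 1) ∈ I * I₂ ^ n := by
  change Ideal.Quotient.mk _ _ = 0 ↔ _
  rw [Ideal.Quotient.eq_zero_iff_mem, mem_fiberIdeal_iff]
  simp only [coeff_divX]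

theorem divXFiberCone_surjective {I : Ideal R} (hI : I₁ ⊓ I₂ ≤ I) :
    Function.Surjective (divXFiberCone hI) := by
  intro b
  obtain ⟨b, rfl⟩ := Ideal.Quotient.mk_surjective b
  have hb : divX ((b : R[X]) * X) = b := by ext; simp
  have hmem : (b : R[X]) * X ∈ reesModuleShift I₁ I₂ := by
    rw [mem_reesModuleShift_iff, hb]
    exact b.2
  refine ⟨⟨_, hmem⟩, congrArg (Ideal.Quotient.mk (fiberIdeal I I₂)) ?_⟩
  exact Subtype.ext hb

theorem mem_mixedReesModule_iff {f : R[X]} :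
    f ∈ mixedReesModule I₁ I₂ ↔ ∀ n, f.coeff n ∈ mixedFiltration I₁ I₂ n := Iff.rfl

theorem mixedReesModule_le : mixedReesModule I₁ I₂ ≤ reesModuleShift I₁ I₂ := by
  intro f hf
  rw [mem_reesModuleShift_iff, mem_reesAlgebra_iff]
  intro n
  rw [coeff_divX]
  exact Ideal.mul_le_right (mem_mixedReesModule_iff.mp hf (n + 1))

theorem reesAlgebra_le_reesModuleShift {f : R[X]} (hf : f ∈ reesAlgebra I₂) :
    f ∈ reesModuleShift I₁ I₂ :=
  divX_mem_reesAlgebra le_rfl hf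

end Sequences

end Rees

/-! ### The module E and its two exact sequences -/

section MixedQuotient

universe u

variable {R : Type u} [CommRing R] (I₁ I₂ : Ideal R)

/-- The quotient of `R ⊕ ⨁_{n ≥ 1} I₂ⁿ⁻¹ tⁿ` by `⨁ I₁ I₂ⁿ tⁿ`. It contains both `F_{I₁}(I₂)` and
`G_{I₁}(I₂)`. -/
abbrev MixedQuotient : Type u :=
  Subquotient (reesModuleShift I₁ I₂) (mixedReesModuleShift I₁ I₂)

noncomputable instance mixedQuotientAddCommGroup : AddCommGroup (MixedQuotient I₁ I₂) :=
  Submodule.Quotient.addCommGroup _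

noncomputable instance mixedQuotientModule :
    Module (reesAlgebra (I₁ ⊓ I₂)) (MixedQuotient I₁ I₂) :=
  Submodule.Quotient.module _

/-- The inclusion of `G_{I₁}(I₂)` into the mixed quotient. -/
noncomputable def mixedInclusion :
    MixedAssocGraded I₁ I₂ →ₗ[reesAlgebra (I₁ ⊓ I₂)] MixedQuotient I₁ I₂ :=
  Submodule.mapQ _ _ (Submodule.inclusion mixedReesModule_le) fun _ hf => hf

theorem mixedInclusion_injective : Function.Injective (mixedInclusion I₁ I₂) := by
  rw [injective_iff_map_eq_zero]
  intro f hf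
  obtain ⟨f, rfl⟩ := Submodule.Quotient.mk_surjective _ f
  exact (Submodule.Quotient.mk_eq_zero _).mpr ((Submodule.Quotient.mk_eq_zero _).mp hf)

variable {I₁ I₂}

/-- Division by `t` as a map from the mixed quotient to `F_I(I₂)`, where `I = I₁` or `I = I₂`. -/
noncomputable def mixedProjection {I : Ideal R} (hI : I₁ ⊓ I₂ ≤ I) (hI' : I₁ * I₂ ≤ I) :
    MixedQuotient I₁ I₂ →ₗ[reesAlgebra (I₁ ⊓ I₂)] FiberCone I I₂ :=
  Submodule.liftQ _ (divXFiberCone hI) fun f hf => by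
    rw [LinearMap.mem_ker, divXFiberCone_eq_zero_iff]
    intro n
    have h : (f : R[X]).coeff (n + 1) ∈ I₁ * I₂ ^ (n + 1) := hf (n + 1)
    rw [pow_succ', ← mul_assoc] at h
    exact Ideal.mul_mono_left hI' h

theorem mixedProjection_mk {I : Ideal R} (hI : I₁ ⊓ I₂ ≤ I) (hI' : I₁ * I₂ ≤ I)
    (f : reesModuleShift I₁ I₂) :
    mixedProjection hI hI' (Submodule.Quotient.mk f) = divXFiberCone hI f := rfl

theorem mixedProjection_surjective {I : Ideal R} (hI : I₁ ⊓ I₂ ≤ I) (hI' : I₁ * I₂ ≤ I) :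
    Function.Surjective (mixedProjection hI hI') := by
  intro b
  obtain ⟨f, hf⟩ := divXFiberCone_surjective hI b
  exact ⟨Submodule.Quotient.mk f, hf⟩

theorem exact_mixedInclusion_mixedProjection :
    Function.Exact (mixedInclusion I₁ I₂)
      (mixedProjection (inf_le_left : I₁ ⊓ I₂ ≤ I₁) Ideal.mul_le_left) := by
  intro f
  constructor
  · intro h
    obtain ⟨f, rfl⟩ := Submodule.Quotient.mk_surjective _ f
    rw [mixedProjection_mk, divXFiberCone_eq_zero_iff] at h
    have hf : (f : R[X]) ∈ mixedReesModule I₁ I₂ := by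
      rintro (_ | n)
      -- Division by t forgets the constant term, and the filtration starts with all of R, so degree
      -- 0 imposes no condition.
      · trivial
      · exact h n
    exact ⟨Submodule.Quotient.mk ⟨f, hf⟩, rfl⟩
  · rintro ⟨g, rfl⟩
    obtain ⟨g, rfl⟩ := Submodule.Quotient.mk_surjective _ g
    have h : mixedInclusion I₁ I₂ (Submodule.Quotient.mk g) =
      Submodule.Quotient.mk (Submodule.inclusion mixedReesModule_le g) := rfl
    rw [h, mixedProjection_mk, divXFiberCone_eq_zero_iff]
    exact fun n => mem_mixedReesModule_iff.mp g.2 (n + 1)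

variable (I₁ I₂)

/-- The inclusion of `F_{I₁}(I₂)` into the mixed quotient. -/
noncomputable def fiberConeInclusion :
    FiberCone I₁ I₂ →ₗ[reesAlgebra (I₁ ⊓ I₂)] MixedQuotient I₁ I₂ where
  toFun := Quotient.map' (fun b : reesAlgebra I₂ =>
      (⟨b, reesAlgebra_le_reesModuleShift b.2⟩ : reesModuleShift I₁ I₂)) fun b c h => by
    have := (Submodule.quotientRel_def _).mp h
    exact (Submodule.quotientRel_def _).mpr this
  map_add' b c := by
    obtain ⟨b, rfl⟩ := Ideal.Quotient.mk_surjective b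
    obtain ⟨c, rfl⟩ := Ideal.Quotient.mk_surjective c
    rfl
  map_smul' a b := by
    obtain ⟨b, rfl⟩ := Ideal.Quotient.mk_surjective b
    rfl

variable {I₁ I₂}

theorem fiberConeInclusion_mk (b : reesAlgebra I₂) :
    fiberConeInclusion I₁ I₂ (Ideal.Quotient.mk _ b) =
      Submodule.Quotient.mk ⟨b, reesAlgebra_le_reesModuleShift b.2⟩ := rfl

theorem fiberConeInclusion_injective : Function.Injective (fiberConeInclusion I₁ I₂) := by
  rw [injective_iff_map_eq_zero]
  intro b hb
  obtain ⟨b, rfl⟩ := Ideal.Quotient.mk_surjective b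
  rw [fiberConeInclusion_mk, Submodule.Quotient.mk_eq_zero] at hb
  exact Ideal.Quotient.eq_zero_iff_mem.mpr hb

theorem exact_fiberConeInclusion_mixedProjection :
    Function.Exact (fiberConeInclusion I₁ I₂)
      (mixedProjection (inf_le_right : I₁ ⊓ I₂ ≤ I₂) Ideal.mul_le_right) := by
  intro f
  constructor
  · intro h
    obtain ⟨f, rfl⟩ := Submodule.Quotient.mk_surjective _ f
    rw [mixedProjection_mk, divXFiberCone_eq_zero_iff] at h
    have hf : (f : R[X]) ∈ reesAlgebra I₂ := by
      rintro (_ | n)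
      · simp
      · rw [pow_succ']
        exact h n
    exact ⟨Ideal.Quotient.mk _ ⟨f, hf⟩, rfl⟩
  · rintro ⟨g, rfl⟩
    obtain ⟨g, rfl⟩ := Ideal.Quotient.mk_surjective g
    rw [fiberConeInclusion_mk, mixedProjection_mk, divXFiberCone_eq_zero_iff]
    intro n
    rw [← pow_succ']
    exact g.2 (n + 1)

/-- Each application of F → E → F shifts the coefficients down by one, through Iⁿ⁺¹ ⊆ Iⁿ for I = I₂.
-/
theorem mixedProjection_fiberConeInclusion_pow (k : ℕ) (b : reesAlgebra I₂) :
    ∃ c : reesAlgebra I₂, (∀ n, (c : R[X]).coeff n = (b : R[X]).coeff (n + k)) ∧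
      ((mixedProjection (inf_le_left : I₁ ⊓ I₂ ≤ I₁) Ideal.mul_le_left ∘ₗ
        fiberConeInclusion I₁ I₂ : Module.End (reesAlgebra (I₁ ⊓ I₂)) (FiberCone I₁ I₂)) ^ k)
          (Ideal.Quotient.mk _ b) = Ideal.Quotient.mk _ c := by
  induction k with
  | zero => exact ⟨b, fun _ => rfl, rfl⟩
  | succ k ih =>
    obtain ⟨c, hc, hbc⟩ := ih
    refine ⟨⟨divX c, divX_mem_reesAlgebra le_rfl c.2⟩, fun n => ?_, ?_⟩
    · rw [coeff_divX, hc]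
      congr 1
      ring
    · rw [pow_succ', Module.End.mul_apply, hbc]
      rfl

theorem isNilpotent_mixedProjection_fiberConeInclusion {N : ℕ}
    (hN : I₂ ^ (N + 1) = (I₁ ⊓ I₂) * I₂ ^ N) :
    IsNilpotent (mixedProjection (inf_le_left : I₁ ⊓ I₂ ≤ I₁) Ideal.mul_le_left ∘ₗ
      fiberConeInclusion I₁ I₂ : Module.End (reesAlgebra (I₁ ⊓ I₂)) (FiberCone I₁ I₂)) := by
  refine ⟨N + 1, LinearMap.ext fun b => ?_⟩
  obtain ⟨b, rfl⟩ := Ideal.Quotient.mk_surjective b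
  obtain ⟨c, hc, hbc⟩ := mixedProjection_fiberConeInclusion_pow (I₁ := I₁) (N + 1) b
  rw [hbc]
  refine Ideal.Quotient.eq_zero_iff_mem.mpr fun n => ?_
  rw [hc]
  -- The shifted coefficient lies in I₂ⁿ⁺ᴺ⁺¹ = (I₁ ∩ I₂) I₂ⁿ⁺ᴺ ⊆ I₁ I₂ⁿ, which is zero in the fiber
  -- cone.
  have h := b.2 (n + (N + 1))
  rw [← add_assoc, pow_succ_eq_mul_of_le hN (Nat.le_add_left N n)] at h
  exact Ideal.mul_mono inf_le_left (Ideal.pow_le_pow_right (Nat.le_add_right n N)) h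

theorem IsReductionOf.exists_pow_eq {J : Ideal R} (hJ : IsReductionOf J I₂) (h : J ≤ I₁) :
    ∃ N, I₂ ^ (N + 1) = (I₁ ⊓ I₂) * I₂ ^ N := by
  obtain ⟨hle, N, hN⟩ := hJ
  refine ⟨N, le_antisymm ?_ ?_⟩
  · rw [hN]
    exact Ideal.mul_mono_left (le_inf h hle)
  · rw [pow_succ']
    exact Ideal.mul_mono_left inf_le_right

end MixedQuotient

/-! ### The depth formula -/

theorem mainTheorem6 {R : Type*} [CommRing R] [IsLocalRing R] [IsNoetherianRing R]
    (I₁ I₂ : Ideal R)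
    (hred : ∃ J : Ideal R, IsReductionOf J I₂ ∧ J ≤ I₁)
    (hdepth : depthAssocGradedRing I₂ < depthMixedAssocGraded I₁ I₂) :
    depthFiberCone I₁ I₂ = depthAssocGradedRing I₂ + 1 := by
  obtain ⟨J, hJ, hJle⟩ := hred
  obtain ⟨N, hN⟩ := hJ.exists_pow_eq hJle
  -- The strict inequality makes depth G(I₂) finite, whereas depth G_{I₁}(I₂) may be ⊤; hence only a
  -- sequence of length n + 1 is extracted from the latter.
  obtain ⟨n, hn⟩ := ENat.ne_top_iff_exists.mp hdepth.ne_top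
  have hG := hn.symm
  rw [depthAssocGradedRing, depthWrt_eq_coe_iff] at hG
  rw [← hn, ← ENat.add_one_le_iff (ENat.natCast_ne_top n)] at hdepth
  have hM : HasRegularSequence (reesMaximalIdeal (I₁ ⊓ I₂)) (n + 1) (MixedAssocGraded I₁ I₂) :=
    coe_le_depthWrt_iff.mp (by
      rw [Nat.cast_succ]
      exact hdepth)
  rw [← hasRegularSequence_fiberCone_iff hN I₂, ← hasRegularSequence_fiberCone_iff hN I₂] at hG
  have := finite_fiberCone_of_pow_eq hN I₁
  have := finite_fiberCone_of_pow_eq hN I₂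
  -- E is finite as an extension of two finite cones, and its submodule G_{I₁}(I₂) is then finite by
  -- noetherianity.
  have : Module.Finite (reesAlgebra (I₁ ⊓ I₂)) (MixedQuotient I₁ I₂) :=
    .of_exact_of_isNoetherianRing exact_fiberConeInclusion_mixedProjection
  have : Module.Finite (reesAlgebra (I₁ ⊓ I₂)) (MixedAssocGraded I₁ I₂) :=
    .of_injective (mixedInclusion I₁ I₂) (mixedInclusion_injective I₁ I₂)
  have hF := hasRegularSequence_of_isNilpotent n (mixedInclusion_injective I₁ I₂)
    exact_mixedInclusion_mixedProjection (mixedProjection_surjective _ _)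
    fiberConeInclusion_injective exact_fiberConeInclusion_mixedProjection
    (mixedProjection_surjective _ _) (isNilpotent_mixedProjection_fiberConeInclusion hN)
    hM hG.1 hG.2
  rw [hasRegularSequence_fiberCone_iff hN, hasRegularSequence_fiberCone_iff hN] at hF
  rw [← hn]
  exact_mod_cast depthWrt_eq_coe_iff.mpr hF
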